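/- Let $V$ be a finite set and let $W=(W_{ij})_{i,j\in V}$ be a nonnegative real matrix with zero diagonal (the weight matrix of a directed network on $V$). For $S\subseteq V$ let $w_i^S=\sum_{j\in S}W_{ij}$, and let $w_i=w_i^V$. For vectors in $\mathbb R^V$, $x\le y$ means $x_i\le y_i$ for all $i$, $x<y$ means $x_i<y_i$ for all $i$, and $x\ngeq y$ means that $x_i<y_i$ for some $i$. Let $h^-\le h^+$ be vectors in $\mathbb R^V$ and $\mathcal H=\{h\in\mathbb R^V: h^-\le h\le h^+\}$; for $s=\pm1$ write $h^s$ for $h^\pm$. The network is called $(h^-,h^+)$-indecomposable if for every partition $V=V^+\cup V^-$ into two disjoint nonempty sets there are a sign $s\in\{-,+\}$ and a node $i\in V^s$ with $w_i^{V^s}+s\,h_i^s<w_i^{V^{-s}}$. Given a (deterministic, measurable) signal $h:[0,\infty)\to\mathcal H$, the asynchronous time-varying linear threshold dynamics (ATV-LTD) with external field $h(t)$ is the random process $X(t)\in\{-1,+1\}^V$, $t\ge0$, with right-continuous piecewise constant paths, defined as follows: the nodes carry independent rate-$1$ Poisson clocks, and $X$ changes only when clocks tick; if the clock of $i$ ticks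 at time $t$, then $X_i(t)$ is $+1$ if $\sum_jW_{ij}X_j(t^-)+h_i(t)>0$, is $-1$ if this number is negative, and is $X_i(t^-)$ if it is zero. Let $\pm\mathbf 1$ denote the two constant (consensus) configurations. Theorem. Suppose that the network is $(h^-,h^+)$-indecomposable. Then for every external field $h(t)\in\mathcal H$, $t\ge0$, and every initial configuration $X(0)$, with probability $1$ there exists $t^*\ge0$ such that (i) $X(t^*)\in\{\pm\mathbf 1\}$; (ii) if $w>-h^-$ and $w>h^+$, then $X(t)\in\{\pm\mathbf 1\}$ for all $t\ge t^*$; (iii) if $w>-a\,h^{-a}$ and $w\ngeq a\,h^{-a}$ for some $a\in\{-1,+1\}$, then $X(t)=a\mathbf 1$ for all $t\ge t^*$. Moreover: (iv) if $w\ngeq-h^-$ and $w\ngeq h^+$, then there exists a signal $h(t)\in\mathcal H$, $t\ge0$, such that, for every initial configuration $X(0)$, with probability $1$ the ATV-LTD with external field $h(t)$ visits both $+\mathbf 1$ and $-\mathbf 1$ infinitely often, that is, each of them at arbitrarily large times. -/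

import Mathlib

open MeasureTheory ProbabilityTheory Filter Topology
open scoped NNReal

/-- A network: a directed weighted graph on the node set `V`, given by its matrix of nonnegative
link weights, with zero diagonal (no self-loops). There is a link from `i` to `j` exactly when
`0 < weight i j`. -/
structure Network (V : Type*) where
  /-- `weight i j` is the weight of the link from `i` to `j`. -/
  weight : V → V → ℝ
  weight_nonneg : ∀ i j, 0 ≤ weight i j
  weight_self : ∀ i, weight i i = 0

/-- A configuration assigns to every node a state in `{+1, -1}`, encoded as `ℤˣ`. The consensus
configurations are the constant functions `1` and `-1`. -/
abbrev Config (V : Type*) := V → ℤˣ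

/-- For a pair of vectors `hm = h⁻` and `hp = h⁺` and a sign `s`, the vector `h^s`. -/
def signField {V : Type*} (hm hp : V → ℝ) (s : ℤˣ) : V → ℝ :=
  if s = 1 then hp else hm

namespace Network

variable {V : Type*} [Fintype V]

/-- The out-degree of `i` restricted to a set `S` of nodes, `∑ j ∈ S, W i j`. -/
def outDegreeOn (G : Network V) (S : Finset V) (i : V) : ℝ :=
  ∑ j ∈ S, G.weight i j

/-- The out-degree `w_i = ∑ j, W i j`. -/
def outDegree (G : Network V) (i : V) : ℝ :=
  G.outDegreeOn Finset.univ i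

/-- `(h⁻, h⁺)`-indecomposability: for every partition of the node set in two nonempty parts,
`part 1 = V⁺` and `part (-1) = V⁻`, some sign `s` and some node `i ∈ V^s` satisfy
`w_i^s + s h_i^s < w_i^{-s}`, where `w_i^s` is the out-degree restricted to `V^s`. -/
def Indecomposable (G : Network V) (hm hp : V → ℝ) : Prop :=
  ∀ part : ℤˣ → Finset V,
    (∀ i, i ∈ part 1 ∨ i ∈ part (-1)) → Disjoint (part 1) (part (-1)) →
    (part 1).Nonempty → (part (-1)).Nonempty →
    ∃ s : ℤˣ, ∃ i ∈ part s,
      G.outDegreeOn (part s) i + ((s : ℤ) : ℝ) * signField hm hp s i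
        < G.outDegreeOn (part (-s)) i

/-- The new state of an activated node `i` when the configuration is `x` and the external field
is `h`: the sign of `∑ j, W i j x j + h i`, or the current state `x i` if that number is zero. -/
noncomputable def update (G : Network V) (h : V → ℝ) (x : Config V) (i : V) : ℤˣ :=
  if 0 < ∑ j, G.weight i j * ((x j : ℤ) : ℝ) + h i then 1
  else if ∑ j, G.weight i j * ((x j : ℤ) : ℝ) + h i < 0 then -1
  else x i

end Network

/-- The counting function `n` (`n t` is the number of ticks up to time `t`) ticks at time `t`. -/
def TicksAt (n : ℝ≥0 → ℕ) (t : ℝ≥0) : Prop :=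
  0 < t ∧ ∀ s < t, n s < n t

open Classical in
/-- `x : ℝ≥0 → Config V` is a trajectory of the linear threshold dynamics on `G` with external
field `h t`, initial configuration `x₀`, and clocks with counting functions `n i`: it starts in
`x₀`, it is right-continuous (for the discrete topology on configurations), and at every time
`t > 0` it has a left limit `y`, the nodes whose clock ticks at `t` are updated from `y` with the
field `h t`, and all other nodes keep their state. -/
structure IsLTDPath {V : Type*} [Fintype V] (G : Network V) (h : ℝ≥0 → V → ℝ)
    (n : V → ℝ≥0 → ℕ) (x₀ : Config V) (x : ℝ≥0 → Config V) : Prop where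
  init : x 0 = x₀
  right_continuous : ∀ t, ∀ᶠ s in 𝓝[>] t, x s = x t
  step : ∀ t, 0 < t → ∃ y : Config V, (∀ᶠ s in 𝓝[<] t, x s = y) ∧
    ∀ i, x t i = if TicksAt (n i) t then G.update (h t) y i else y i

section Probability

variable {Ω : Type*} [MeasurableSpace Ω]

/-- `N` is (the counting process of) a Poisson clock of rate `1`: it starts at zero, its paths are
almost surely nondecreasing and right-continuous, and its increments are independent and
Poisson distributed with parameter the length of the time interval. -/
structure IsPoissonClock (N : ℝ≥0 → Ω → ℕ) (P : Measure Ω) : Prop where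
  measurable : ∀ t, Measurable (N t)
  zero : ∀ᵐ ω ∂P, N 0 ω = 0
  mono : ∀ᵐ ω ∂P, Monotone fun t => N t ω
  right_continuous : ∀ᵐ ω ∂P, ∀ t, ContinuousWithinAt (fun s => N s ω) (Set.Ici t) t
  indep_increments : HasIndepIncrements N P
  law_increments : ∀ s t, s ≤ t → HasLaw (fun ω => N t ω - N s ω) (poissonMeasure (t - s)) P

/-- `X` is the asynchronous time-varying linear threshold dynamics on `G` with (deterministic)
external field `h`, started in `x₀` and driven by the clocks with counting processes `N i`,
which are independent rate-`1` Poisson clocks. -/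
structure IsATVLTD {V : Type*} [Fintype V] (G : Network V) (h : ℝ≥0 → V → ℝ) (x₀ : Config V)
    (N : V → ℝ≥0 → Ω → ℕ) (X : ℝ≥0 → Ω → Config V) (P : Measure Ω) : Prop where
  clock : ∀ i, IsPoissonClock (N i) P
  indep : iIndepFun (fun i ω t => N i t ω) P
  path : ∀ᵐ ω ∂P, IsLTDPath G h (fun i t => N i t ω) x₀ (fun t => X t ω)

end Probability

/-! Indecomposability, applied to the partition of a non-consensus configuration by state, gives a
node that must switch to the opposite state `a` under every field of the box, since its inequality
is tested at the field least favourable to `a`. Consensus is therefore reachable by forced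
single-node updates: switch nodes to `a` as long as one in state `-a` is forced to. Once none is,
only switches to `-a` are available; as weights are nonnegative, these never create a new incentive
for `a`, so they continue to unanimity (`reach_neg`, `reach_consensus`).

Chance enters through one fact: the set of clocks ticking in `(k, k + 1]` is a prescribed `B` with
positive probability, independent of the past and of the value of `k`. By Lévy's Borel-Cantelli
lemma, a configuration visited at infinitely many integer times is infinitely often followed by the
desired ticks (`ae_frequently_tickEvent`). The recurrent configurations are thus closed under forced
updates (`ae_frequently_of_reach`), and finiteness of the configuration space provides one, so a
consensus recurs. The argument needs the configuration at time `k` to be determined measurably by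
the clocks up to `k`; this comes from discretising time (`eventually_gridState_eq`).

In (ii) both consensuses are absorbing. In (iii) a stubborn node forces the consensus to be `a`,
which is absorbing. In (iv) some node leaves even the consensus on `-a` under `h^a`, so `a` is
reachable from everywhere; alternating the two extreme fields makes both consensuses recur. -/

/-! ### Attraction to a state and reachability of consensus -/

theorem cast_units_mul_self (a : ℤˣ) : ((a : ℤ) : ℝ) * ((a : ℤ) : ℝ) = 1 := by
  rcases Int.units_eq_one_or a with rfl | rfl <;> simp

theorem neg_one_le_cast_units_mul (a b : ℤˣ) : -1 ≤ ((a : ℤ) : ℝ) * ((b : ℤ) : ℝ) := by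
  rcases Int.units_eq_one_or a with rfl | rfl <;> rcases Int.units_eq_one_or b with rfl | rfl <;>
    norm_num

theorem units_eq_neg_of_ne {a b : ℤˣ} (h : b ≠ a) : b = -a := by
  rcases Int.units_eq_one_or a with rfl | rfl <;> rcases Int.units_eq_one_or b with rfl | rfl <;>
    simp_all

/-- Within the box, `h^(-a)` is the field least favourable to `a`, so testing attraction there
covers every field. -/
theorem mul_signField_neg_le {V : Type*} {hm hp h : V → ℝ} (hh : h ∈ Set.Icc hm hp) (a : ℤˣ)
    (i : V) : ((a : ℤ) : ℝ) * signField hm hp (-a) i ≤ ((a : ℤ) : ℝ) * h i := by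
  have h1 := hh.1 i
  have h2 := hh.2 i
  rcases Int.units_eq_one_or a with rfl | rfl
  · have : ¬ (-1 : ℤˣ) = 1 := by decide
    simpa [signField, this] using h1
  · simpa [signField] using h2

theorem signField_mem_Icc {V : Type*} {hm hp : V → ℝ} (hle : hm ≤ hp) (a : ℤˣ) :
    signField hm hp a ∈ Set.Icc hm hp := by
  unfold signField
  split_ifs
  · exact ⟨hle, le_rfl⟩
  · exact ⟨le_rfl, hle⟩

namespace Network

variable {V : Type*} [Fintype V]

/-- The input `∑ j, W i j x j` that node `i` receives from the other nodes. -/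
def drive (G : Network V) (x : Config V) (i : V) : ℝ :=
  ∑ j, G.weight i j * ((x j : ℤ) : ℝ)

theorem drive_congr (G : Network V) {x y : Config V} {i : V} (h : ∀ j, j ≠ i → y j = x j) :
    G.drive y i = G.drive x i := by
  refine Finset.sum_congr rfl fun j _ => ?_
  by_cases hj : j = i
  · subst hj; simp [G.weight_self]
  · rw [h j hj]

theorem mul_drive_mono (G : Network V) {x y : Config V} {a : ℤˣ} (i : V)
    (h : ∀ j, y j = -a ∨ y j = x j) :
    ((a : ℤ) : ℝ) * G.drive y i ≤ ((a : ℤ) : ℝ) * G.drive x i := by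
  unfold drive
  rw [Finset.mul_sum, Finset.mul_sum]
  refine Finset.sum_le_sum fun j _ => ?_
  have key : ((a : ℤ) : ℝ) * ((y j : ℤ) : ℝ) ≤ ((a : ℤ) : ℝ) * ((x j : ℤ) : ℝ) := by
    rcases h j with h | h
    · rw [h]
      have := neg_one_le_cast_units_mul a (x j)
      have h1 := cast_units_mul_self a
      push_cast
      linarith
    · rw [h]
  have := mul_le_mul_of_nonneg_left key (G.weight_nonneg i j)
  linarith

theorem drive_const (G : Network V) (a : ℤˣ) (i : V) :
    G.drive (fun _ => a) i = ((a : ℤ) : ℝ) * G.outDegree i := by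
  simp [drive, outDegree, outDegreeOn, Finset.mul_sum, mul_comm]

theorem neg_outDegree_le_mul_drive (G : Network V) (x : Config V) (a : ℤˣ) (i : V) :
    -G.outDegree i ≤ ((a : ℤ) : ℝ) * G.drive x i := by
  have := G.mul_drive_mono (x := x) (y := fun _ => -a) (a := a) i (fun j => Or.inl rfl)
  rw [drive_const] at this
  have h1 := cast_units_mul_self a
  push_cast at this
  linear_combination this + G.outDegree i * h1

theorem update_eq_of_pos (G : Network V) {h : V → ℝ} {x : Config V} {i : V} {a : ℤˣ}
    (hpos : 0 < ((a : ℤ) : ℝ) * G.drive x i + ((a : ℤ) : ℝ) * h i) : G.update h x i = a := by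
  unfold update
  unfold drive at hpos
  rcases Int.units_eq_one_or a with rfl | rfl
  · rw [if_pos]; simpa using hpos
  · rw [if_neg, if_pos] <;> simp at hpos ⊢ <;> linarith

/-- Node `i` is attracted to the state `a` at the configuration `x`, for all fields between
`hm` and `hp`. -/
def Attracted (G : Network V) (hm hp : V → ℝ) (a : ℤˣ) (x : Config V) (i : V) : Prop :=
  0 < ((a : ℤ) : ℝ) * G.drive x i + ((a : ℤ) : ℝ) * signField hm hp (-a) i

theorem Attracted.update_eq {G : Network V} {hm hp h : V → ℝ} {a : ℤˣ} {x : Config V} {i : V}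
    (hx : G.Attracted hm hp a x i) (hh : h ∈ Set.Icc hm hp) : G.update h x i = a := by
  have := mul_signField_neg_le hh a i
  unfold Attracted at hx
  exact G.update_eq_of_pos (by linarith)

theorem outDegreeOn_sub_outDegreeOn_neg (G : Network V) (x : Config V) (s : ℤˣ) (i : V) :
    G.outDegreeOn (Finset.univ.filter fun j => x j = s) i
      - G.outDegreeOn (Finset.univ.filter fun j => x j = -s) i = ((s : ℤ) : ℝ) * G.drive x i := by
  unfold outDegreeOn drive
  rw [Finset.sum_filter, Finset.sum_filter, ← Finset.sum_sub_distrib, Finset.mul_sum]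
  refine Finset.sum_congr rfl fun j _ => ?_
  have h1 := cast_units_mul_self s
  have hne : s ≠ -s := by rcases Int.units_eq_one_or s with rfl | rfl <;> decide
  by_cases h : x j = s
  · rw [if_pos h, if_neg (by rw [h]; exact hne), h]; linear_combination (-G.weight i j) * h1
  · have h' := units_eq_neg_of_ne h
    rw [if_neg h, if_pos h', h']; push_cast; linear_combination (G.weight i j) * h1

/-- The partition by state turns the inequality of indecomposability into attraction of a node to
the state it does not have. -/
theorem Indecomposable.exists_attracted {G : Network V} {hm hp : V → ℝ}
    (hind : G.Indecomposable hm hp) {x : Config V} (h1 : ∃ i, x i = 1) (h2 : ∃ i, x i = -1) :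
    ∃ a i, x i = -a ∧ G.Attracted hm hp a x i := by
  obtain ⟨s, i, hi, hlt⟩ := hind (fun s => Finset.univ.filter fun j => x j = s)
    (fun i => by simpa using Int.units_eq_one_or (x i))
    (by
      rw [Finset.disjoint_filter]
      intro j _ h h'
      rw [h] at h'
      exact absurd h' (by decide))
    (by obtain ⟨i, hi⟩ := h1; exact ⟨i, by simpa using hi⟩)
    (by obtain ⟨i, hi⟩ := h2; exact ⟨i, by simpa using hi⟩)
  refine ⟨-s, i, by simpa using hi, ?_⟩
  have := G.outDegreeOn_sub_outDegreeOn_neg x s i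
  unfold Attracted
  rw [neg_neg]
  push_cast
  linarith

theorem Attracted.not_neg {G : Network V} {hm hp : V → ℝ} (hle : hm ≤ hp) {a : ℤˣ}
    {x : Config V} {i : V} (hx : G.Attracted hm hp a x i) : ¬ G.Attracted hm hp (-a) x i := by
  intro hx'
  have h1 := hx.update_eq ⟨le_rfl, hle⟩
  have h2 := hx'.update_eq ⟨le_rfl, hle⟩
  rw [h1] at h2
  rcases Int.units_eq_one_or a with rfl | rfl <;> exact absurd h2 (by decide)

/-- `y` arises from `x` by the activation of one node, whatever the field in `𝓗` is. -/
def Move (G : Network V) (𝓗 : Set (V → ℝ)) (x y : Config V) : Prop :=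
  ∃ i, (∀ j, j ≠ i → y j = x j) ∧ ∀ h ∈ 𝓗, G.update h x i = y i

theorem Move.mono {G : Network V} {𝓗 𝓗' : Set (V → ℝ)} (hsub : 𝓗 ⊆ 𝓗') {x y : Config V}
    (h : G.Move 𝓗' x y) : G.Move 𝓗 x y := by
  obtain ⟨i, h1, h2⟩ := h
  exact ⟨i, h1, fun h hh => h2 h (hsub hh)⟩

open Classical in
theorem Attracted.move {G : Network V} {hm hp : V → ℝ} {a : ℤˣ} {x : Config V} {i : V}
    (hx : G.Attracted hm hp a x i) :
    G.Move (Set.Icc hm hp) x (Function.update x i a) :=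
  ⟨i, fun j hj => by simp [hj], fun h hh => by simpa using hx.update_eq hh⟩

open Classical in
theorem card_filter_update_lt {x : Config V} {i : V} {a : ℤˣ} (hi : x i = a) :
    (Finset.univ.filter fun j => Function.update x i (-a) j = a).card
      < (Finset.univ.filter fun j => x j = a).card := by
  have hne : -a ≠ a := by rcases Int.units_eq_one_or a with rfl | rfl <;> decide
  refine Finset.card_lt_card ((Finset.ssubset_iff_of_subset fun j hj => ?_).2 ⟨i, ?_, ?_⟩)
  · rcases eq_or_ne j i with rfl | h
    · simpa using hi
    · simpa [h] using hj
  · simpa using hi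
  · simp

open Classical in
/-- If no node in the state `-a` is attracted to `a`, and there is such a node, then successive
switches to `-a` lead to the consensus on `-a`. -/
theorem Indecomposable.reach_neg {G : Network V} {hm hp : V → ℝ} (hle : hm ≤ hp)
    (hind : G.Indecomposable hm hp) (a : ℤˣ) (x : Config V) (hex : ∃ i, x i = -a)
    (hno : ∀ i, x i = -a → ¬ G.Attracted hm hp a x i) :
    Relation.ReflTransGen (G.Move (Set.Icc hm hp)) x (fun _ => -a) := by
  induction hn : (Finset.univ.filter fun j => x j = a).card using Nat.strong_induction_on
    generalizing x with
  | _ n ih =>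
  by_cases hall : ∀ i, x i = -a
  · rw [funext hall]
  push Not at hall
  obtain ⟨i₀, hi₀⟩ := hall
  replace hi₀ := units_eq_neg_of_ne hi₀
  rw [neg_neg] at hi₀
  obtain ⟨b, i, hi, hatt⟩ := hind.exists_attracted (x := x)
    (by rcases Int.units_eq_one_or a with rfl | rfl
        exacts [⟨i₀, hi₀⟩, hex])
    (by rcases Int.units_eq_one_or a with rfl | rfl
        exacts [hex, ⟨i₀, hi₀⟩])
  have hba : b ≠ a := by
    rintro rfl
    exact hno i hi hatt
  obtain rfl := units_eq_neg_of_ne hba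
  rw [neg_neg] at hi
  -- The switch to `-a` preserves `hno`. The switched node ignores its own state (zero diagonal), so
  -- it would be attracted to both signs at `x`; for any other node the pull towards `a` can only
  -- decrease.
  refine Relation.ReflTransGen.head hatt.move
    (ih _ (hn ▸ card_filter_update_lt hi) _ ⟨i, by simp⟩ (fun j hj hatt' => ?_) rfl)
  rcases eq_or_ne j i with rfl | hji
  · refine hatt.not_neg hle ?_
    unfold Attracted at hatt' ⊢
    rw [neg_neg]
    rwa [G.drive_congr (x := x) (fun k hk => by simp [hk])] at hatt'
  · refine hno j (by simpa [hji] using hj) ?_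
    have := G.mul_drive_mono (x := x) (y := Function.update x i (-a)) (a := a) j (fun k => by
      rcases eq_or_ne k i with rfl | h
      · simp
      · simp [h])
    unfold Attracted at hatt' ⊢
    linarith

open Classical in
/-- From every configuration, some consensus can be reached. -/
theorem Indecomposable.reach_consensus {G : Network V} {hm hp : V → ℝ} (hle : hm ≤ hp)
    (hind : G.Indecomposable hm hp) (a : ℤˣ) (x : Config V) :
    Relation.ReflTransGen (G.Move (Set.Icc hm hp)) x (fun _ => a) ∨
      Relation.ReflTransGen (G.Move (Set.Icc hm hp)) x (fun _ => -a) := by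
  induction hn : (Finset.univ.filter fun j => x j = -a).card using Nat.strong_induction_on
    generalizing x with
  | _ n ih =>
  by_cases hno : ∀ i, x i = -a → ¬ G.Attracted hm hp a x i
  · by_cases hex : ∃ i, x i = -a
    · exact Or.inr (hind.reach_neg hle a x hex hno)
    · push Not at hex
      left
      rw [funext fun i => (units_eq_neg_of_ne (hex i)).trans (neg_neg a)]
  · push Not at hno
    obtain ⟨i, hi, hatt⟩ := hno
    have hlt := card_filter_update_lt hi
    rw [neg_neg] at hlt
    exact (ih _ (hn ▸ hlt) _ rfl).imp (.head hatt.move) (.head hatt.move)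

open Classical in
/-- If under the extreme field `h^a` some node always prefers `a`, then the consensus on `a` can be
reached from every configuration under this field. -/
theorem Indecomposable.reach_of_signField {G : Network V} {hm hp : V → ℝ} (hle : hm ≤ hp)
    (hind : G.Indecomposable hm hp) (a : ℤˣ) {i : V}
    (hi : G.outDegree i < ((a : ℤ) : ℝ) * signField hm hp a i) (x : Config V) :
    Relation.ReflTransGen (G.Move {signField hm hp a}) x (fun _ => a) := by
  have hsub : ({signField hm hp a} : Set (V → ℝ)) ⊆ Set.Icc hm hp := by
    simpa using signField_mem_Icc hle a
  have lift {y z : Config V} (h : Relation.ReflTransGen (G.Move (Set.Icc hm hp)) y z) :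
      Relation.ReflTransGen (G.Move {signField hm hp a}) y z :=
    Relation.ReflTransGen.mono (fun _ _ => Move.mono hsub) _ _ h
  rcases hind.reach_consensus hle a x with h | h
  · exact lift h
  have hstep : G.Move {signField hm hp a} (fun _ => -a) (Function.update (fun _ => -a) i a) := by
    refine ⟨i, fun j hj => by simp [hj], ?_⟩
    rintro h rfl
    have := G.neg_outDegree_le_mul_drive (fun _ => -a) a i
    simpa using G.update_eq_of_pos (x := fun _ => -a) (a := a) (i := i) (by linarith)
  -- Only `i` is now in state `a`, and under `h^a` it is not attracted back, so `reach_neg` applies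
  -- with the signs exchanged.
  have hreach := hind.reach_neg hle (-a) (Function.update (fun _ => -a) i a) ⟨i, by simp⟩ ?_
  · rw [neg_neg] at hreach
    exact (lift h).trans (.head hstep (lift hreach))
  · intro j hj hatt
    have hne : a ≠ -a := by rcases Int.units_eq_one_or a with rfl | rfl <;> decide
    rcases eq_or_ne j i with rfl | hji
    · unfold Attracted at hatt
      rw [G.drive_congr (x := fun _ => -a) (fun k hk => by simp [hk]), drive_const] at hatt
      have h1 := cast_units_mul_self a
      push_cast at hatt
      rw [neg_neg] at hatt
      have h2 : -((a : ℤ) : ℝ) * (-((a : ℤ) : ℝ) * G.outDegree j) = G.outDegree j := by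
        linear_combination G.outDegree j * h1
      linarith
    · simp only [Function.update_of_ne hji, neg_neg] at hj
      exact hne hj.symm

end Network

/-! ### Counting paths and trajectories -/

/-- Continuous induction for a property which is unchanged just to the right of every time. -/
theorem forall_mem_Icc_of_left_of_right {f : ℝ≥0 → Prop} {a b : ℝ≥0} (ha : f a)
    (hl : ∀ t ∈ Set.Ioc a b, (∃ᶠ s in 𝓝[<] t, f s) → f t)
    (hr : ∀ t, ∀ᶠ s in 𝓝[>] t, (f s ↔ f t)) : ∀ t ∈ Set.Icc a b, f t := by
  have hclosed : IsClosed ({t | f t} ∩ Set.Icc a b) := by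
    rw [isClosed_iff_frequently]
    intro t ht
    have htI : t ∈ Set.Icc a b :=
      isClosed_Icc.mem_of_frequently_of_tendsto (ht.mono fun s hs => hs.2) tendsto_id
    refine ⟨?_, htI⟩
    rw [← nhdsLT_sup_nhdsGE, frequently_sup] at ht
    rcases ht with ht | ht
    · obtain ⟨s, hs, hst⟩ := (ht.and_eventually self_mem_nhdsWithin).exists
      exact hl t ⟨hs.2.1.trans_lt hst, htI.2⟩ (ht.mono fun s hs => hs.1)
    · by_contra hft
      refine ht ?_
      rw [← Set.Ioi_insert, nhdsWithin_insert, eventually_sup]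
      refine ⟨by simpa using fun h => absurd h hft, ?_⟩
      filter_upwards [hr t] with s hs hs'
      exact hft (hs.1 hs'.1)
  refine hclosed.Icc_subset_of_forall_mem_nhdsWithin ha fun t ht => ?_
  filter_upwards [hr t] with s hs using hs.2 ht.1

/-- A counting path: nondecreasing, right-continuous and started at zero. -/
structure IsCountingPath (c : ℝ≥0 → ℕ) : Prop where
  zero : c 0 = 0
  mono : Monotone c
  right_continuous : ∀ t, ContinuousWithinAt c (Set.Ici t) t

namespace IsCountingPath

variable {c : ℝ≥0 → ℕ}

/-- The tick is the infimum of the times at which the count has reached `c b`; right-continuity of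
an integer-valued path makes it attained. -/
theorem exists_last_tick (hc : IsCountingPath c) {a b : ℝ≥0} (hab : c a < c b) :
    ∃ s ∈ Set.Ioc a b, c s = c b ∧ ∀ u < s, c u < c b := by
  set S : Set ℝ≥0 := {u | c b ≤ c u} with hS
  have hb : b ∈ S := le_refl (c b)
  have hmem : sInf S ∈ S := by
    have h1 : ∀ᶠ u in 𝓝[>] (sInf S), c u = c (sInf S) :=
      (tendsto_pure.1 (by simpa [nhds_discrete] using (hc.right_continuous (sInf S)).tendsto)
        : ∀ᶠ u in 𝓝[≥] (sInf S), c u = c (sInf S)).filter_mono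
        (nhdsWithin_mono _ Set.Ioi_subset_Ici_self)
    obtain ⟨u, hu, hlt⟩ := (h1.and self_mem_nhdsWithin).exists
    obtain ⟨v, hv, hvu⟩ := exists_lt_of_csInf_lt ⟨b, hb⟩ hlt
    exact (le_trans hv (hc.mono hvu.le)).trans_eq hu
  have hle : sInf S ≤ b := csInf_le (OrderBot.bddBelow S) hb
  refine ⟨sInf S, ⟨?_, hle⟩, le_antisymm (hc.mono hle) hmem, fun u hu => ?_⟩
  · by_contra h
    exact absurd (le_trans hmem (hc.mono (not_lt.1 h))) (not_le.2 hab)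
  · by_contra h
    exact absurd (csInf_le (OrderBot.bddBelow S) (not_lt.1 h : u ∈ S)) (not_le.2 hu)

theorem exists_tick (hc : IsCountingPath c) {a b : ℝ≥0} (hab : c a < c b) :
    ∃ s ∈ Set.Ioc a b, TicksAt c s := by
  obtain ⟨s, hs, h1, h2⟩ := hc.exists_last_tick hab
  exact ⟨s, hs, (zero_le).trans_lt hs.1, fun u hu => h1 ▸ h2 u hu⟩

theorem lt_of_tick (hc : IsCountingPath c) {a b t : ℝ≥0} (ht : t ∈ Set.Ioc a b)
    (htick : TicksAt c t) : c a < c b :=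
  (htick.2 a ht.1).trans_le (hc.mono ht.2)

theorem finite_ticks (hc : IsCountingPath c) (b : ℝ≥0) :
    {t | t ≤ b ∧ TicksAt c t}.Finite := by
  refine Set.Finite.of_injOn (f := c) (t := Set.Iic (c b)) (fun t ht => hc.mono ht.1) ?_
    (Set.finite_Iic _)
  intro s hs t ht hst
  rcases lt_trichotomy s t with h | h | h
  · exact absurd hst (ht.2.2 s h).ne
  · exact h
  · exact absurd hst (hs.2.2 t h).ne'

end IsCountingPath

/-- The time of the last tick up to time `t`, as an infimum over countably many times. -/
noncomputable def lastTick (c : ℝ≥0 → ℕ) (t : ℝ≥0) : ℝ≥0 :=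
  ⨅ m : ℕ, if c (min (TopologicalSpace.denseSeq ℝ≥0 m) t) = c t
    then min (TopologicalSpace.denseSeq ℝ≥0 m) t else t

theorem IsCountingPath.lastTick_eq {c : ℝ≥0 → ℕ} (hc : IsCountingPath c) {s t : ℝ≥0}
    (hst : s ≤ t) (hs : c s = c t) (hlt : ∀ u < s, c u < c t) : lastTick c t = s := by
  have hge {u : ℝ≥0} (hu : c u = c t) : s ≤ u := by
    by_contra h
    exact absurd hu (hlt u (not_le.1 h)).ne
  apply le_antisymm
  · refine le_of_forall_gt_imp_ge_of_dense fun r hr => ?_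
    obtain ⟨m, hm⟩ := (TopologicalSpace.denseRange_denseSeq ℝ≥0).exists_mem_open
      isOpen_Ioo (Set.nonempty_Ioo.2 hr)
    refine (ciInf_le (OrderBot.bddBelow _) m).trans ?_
    rw [if_pos]
    · exact (min_le_left _ _).trans hm.2.le
    · exact le_antisymm (hc.mono (min_le_right _ _)) (hs ▸ hc.mono (le_min hm.1.le hst))
  · refine le_ciInf fun m => ?_
    split_ifs with h
    · exact hge h
    · exact hst

/-- Updating a node is idempotent for a fixed field because its input does not involve its own
state; repeated ticks of one clock are then harmless. -/
theorem Network.update_of_eq_update {V : Type*} [Fintype V] (G : Network V) {h : V → ℝ}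
    {x y : Config V} {i : V} (hoff : ∀ j, j ≠ i → y j = x j) (hi : G.update h x i = y i) :
    G.update h y i = y i := by
  have hd := G.drive_congr hoff
  unfold Network.drive at hd
  unfold Network.update at hi ⊢
  rw [hd]
  split_ifs at hi ⊢ <;> first | exact hi | rfl

namespace IsLTDPath

variable {V : Type*} [Fintype V] {G : Network V} {h : ℝ≥0 → V → ℝ} {n : V → ℝ≥0 → ℕ}
  {x₀ : Config V} {x : ℝ≥0 → Config V}

open Classical in
/-- A property of configurations that survives all updates in `(a, b]` is preserved. -/
theorem invariant (hx : IsLTDPath G h n x₀ x) (Q : Config V → Prop) {a b : ℝ≥0} (ha : Q (x a))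
    (hstep : ∀ t ∈ Set.Ioc a b, ∀ y z : Config V, Q y →
      (∀ i, z i = if TicksAt (n i) t then G.update (h t) y i else y i) → Q z) :
    ∀ t ∈ Set.Icc a b, Q (x t) := by
  refine forall_mem_Icc_of_left_of_right (f := fun t => Q (x t)) ha (fun t ht hfreq => ?_)
    (fun t => (hx.right_continuous t).mono fun s hs => by rw [hs])
  obtain ⟨y, hy, hupd⟩ := hx.step t ((zero_le).trans_lt ht.1)
  obtain ⟨s, hs, hs'⟩ := (hfreq.and_eventually hy).exists
  exact hstep t ht y (x t) (hs' ▸ hs) hupd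

theorem eq_of_no_tick (hx : IsLTDPath G h n x₀ x) {a b : ℝ≥0} (hab : a ≤ b)
    (hno : ∀ i, ∀ t ∈ Set.Ioc a b, ¬ TicksAt (n i) t) : x b = x a := by
  refine hx.invariant (fun c => c = x a) rfl (fun t ht y z hy hz => ?_) b ⟨hab, le_rfl⟩
  funext i
  rw [hz i, if_neg (hno i t ht), hy]

open Classical in
/-- If the ticks in `(a, s]` can only occur at `s`, the configuration at `s` is obtained from the
one at `a`. -/
theorem step_of_no_tick (hx : IsLTDPath G h n x₀ x) {a s : ℝ≥0} (has : a < s)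
    (hno : ∀ i, ∀ t ∈ Set.Ioo a s, ¬ TicksAt (n i) t) (i : V) :
    x s i = if TicksAt (n i) s then G.update (h s) (x a) i else x a i := by
  obtain ⟨y, hy, hupd⟩ := hx.step s ((zero_le).trans_lt has)
  have := nhdsLT_neBot_of_exists_lt ⟨a, has⟩
  obtain ⟨t, ht, ht'⟩ := (hy.and (Ioo_mem_nhdsLT has)).exists
  have : y = x a := by
    rw [← ht]
    exact hx.eq_of_no_tick ht'.1.le fun i u hu => hno i u ⟨hu.1, hu.2.trans_lt ht'.2⟩
  rw [hupd i, this]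

open Classical in
/-- If all ticks in `(a, b]` are simultaneous, the configuration at `b` is obtained from the one at
`a` by a single update. -/
theorem step_of_subsingleton (hx : IsLTDPath G h n x₀ x) (hn : ∀ i, IsCountingPath (n i))
    {a b : ℝ≥0} (hab : a ≤ b)
    (hsub : ∀ i j, ∀ s ∈ Set.Ioc a b, ∀ t ∈ Set.Ioc a b, TicksAt (n i) s → TicksAt (n j) t →
      s = t) (i : V) :
    x b i = if n i a < n i b then G.update (h (lastTick (n i) b)) (x a) i else x a i := by
  by_cases hex : ∃ j, ∃ s ∈ Set.Ioc a b, TicksAt (n j) s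
  · obtain ⟨j, s, hs, hjs⟩ := hex
    have h1 : x b = x s := hx.eq_of_no_tick hs.2 fun k t ht hkt =>
      ht.1.ne (hsub j k s hs t ⟨hs.1.trans ht.1, ht.2⟩ hjs hkt)
    have h2 := hx.step_of_no_tick hs.1 (fun k t ht hkt =>
      ht.2.ne' (hsub j k s hs t ⟨ht.1, ht.2.le.trans hs.2⟩ hjs hkt)) i
    rw [h1, h2]
    by_cases hlt : n i a < n i b
    · obtain ⟨t, ht, ht1, ht2⟩ := (hn i).exists_last_tick hlt
      have htick : TicksAt (n i) t := ⟨(zero_le).trans_lt ht.1, fun u hu => ht1 ▸ ht2 u hu⟩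
      obtain rfl : s = t := hsub j i s hs t ht hjs htick
      rw [if_pos htick, if_pos hlt, (hn i).lastTick_eq ht.2 ht1 ht2]
    · rw [if_neg hlt, if_neg fun htick => hlt ((hn i).lt_of_tick hs htick)]
  · push Not at hex
    rw [hx.eq_of_no_tick hab hex, if_neg fun hlt => ?_]
    obtain ⟨s, hs, htick⟩ := (hn i).exists_tick hlt
    exact hex i s hs htick

open Classical in
/-- If only the clock of `i` ticks in `(a, b]` and this node always moves to `y i`, then the
configuration at `b` is `y`. -/
theorem eq_of_single_tick (hx : IsLTDPath G h n x₀ x) (hn : ∀ i, IsCountingPath (n i))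
    {a b : ℝ≥0} {i : V} (htick : ∀ j, n j a < n j b ↔ j = i) {y : Config V}
    (hoff : ∀ j, j ≠ i → y j = x a j)
    (hi : ∀ t ∈ Set.Ioc a b, G.update (h t) (x a) i = y i) : x b = y := by
  have hno : ∀ j, j ≠ i → ∀ t ∈ Set.Ioc a b, ¬ TicksAt (n j) t := fun j hj t ht hjt =>
    hj ((htick j).1 ((hn j).lt_of_tick ht hjt))
  have hxy : ∀ z : Config V, (∀ j, j ≠ i → z j = x a j) → z i = y i → z = y := by
    intro z h1 h2
    funext j
    rcases eq_or_ne j i with rfl | hj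
    · exact h2
    · rw [h1 j hj, hoff j hj]
  have hself : ∀ t ∈ Set.Ioc a b, G.update (h t) y i = y i := fun t ht =>
    G.update_of_eq_update hoff (hi t ht)
  -- The clock of `i` may tick several times, but `y` is fixed by all these updates, so the path
  -- only takes the values `x a` and `y`.
  have hor : ∀ t ∈ Set.Icc a b, x t = x a ∨ x t = y := by
    refine hx.invariant (fun c => c = x a ∨ c = y) (Or.inl rfl) fun t ht u z hu hz => ?_
    have hz' : ∀ j, j ≠ i → z j = x a j := by
      intro j hj
      rw [hz j, if_neg (hno j hj t ht)]
      rcases hu with rfl | rfl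
      exacts [rfl, hoff j hj]
    by_cases hit : TicksAt (n i) t
    · refine Or.inr (hxy z hz' ?_)
      rw [hz i, if_pos hit]
      rcases hu with rfl | rfl
      exacts [hi t ht, hself t ht]
    · have : z i = u i := by rw [hz i, if_neg hit]
      rcases hu with rfl | rfl
      · left
        funext j
        rcases eq_or_ne j i with rfl | hj
        exacts [this, hz' j hj]
      · exact Or.inr (hxy z hz' this)
  obtain ⟨s, hs, his⟩ := (hn i).exists_tick ((htick i).2 rfl)
  have hxs : x s = y := by
    obtain ⟨u, hu, hupd⟩ := hx.step s ((zero_le).trans_lt hs.1)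
    have := nhdsLT_neBot_of_exists_lt ⟨a, hs.1⟩
    obtain ⟨t, ht, ht'⟩ := (hu.and (Ioo_mem_nhdsLT hs.1)).exists
    have hu' := hor t ⟨ht'.1.le, ht'.2.le.trans hs.2⟩
    rw [ht] at hu'
    refine hxy _ (fun j hj => ?_) ?_
    · rw [hupd j, if_neg (hno j hj s hs)]
      rcases hu' with rfl | rfl
      exacts [rfl, hoff j hj]
    · rw [hupd i, if_pos his]
      rcases hu' with rfl | rfl
      exacts [hi s hs, hself s hs]
  refine hx.invariant (fun c => c = y) hxs (fun t ht u z hu hz => ?_) b ⟨hs.2, le_rfl⟩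
  have ht' : t ∈ Set.Ioc a b := ⟨hs.1.trans ht.1, ht.2⟩
  subst hu
  funext j
  rw [hz j]
  split_ifs with hjt
  · rcases eq_or_ne j i with rfl | hj
    · exact hself t ht'
    · exact absurd hjt (hno j hj t ht')
  · rfl

end IsLTDPath

/-! ### Discretisation of time and measurability -/

section Grid

variable {V : Type*} [Fintype V]

/-- The configuration at time `j δ` computed as if all ticks in each interval `(k δ, (k + 1) δ]`
were simultaneous. -/
noncomputable def gridState (G : Network V) (h : ℝ≥0 → V → ℝ) (n : V → ℝ≥0 → ℕ) (x₀ : Config V)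
    (δ : ℝ≥0) : ℕ → Config V
  | 0 => x₀
  | j + 1 => fun i =>
      if n i (j * δ) < n i ((j + 1 : ℕ) * δ)
      then G.update (h (lastTick (n i) ((j + 1 : ℕ) * δ))) (gridState G h n x₀ δ j) i
      else gridState G h n x₀ δ j i

/-- Only finitely many tick times precede `k`, so on a fine enough grid no cell contains two
distinct ones and the discretisation is exact. With mesh `1 / (m + 1)`, the grid point of index `k *
(m + 1)` is `k`. -/
theorem IsLTDPath.eventually_gridState_eq {G : Network V} {h : ℝ≥0 → V → ℝ} {n : V → ℝ≥0 → ℕ}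
    {x₀ : Config V} {x : ℝ≥0 → Config V} (hx : IsLTDPath G h n x₀ x)
    (hn : ∀ i, IsCountingPath (n i)) (k : ℕ) :
    ∀ᶠ m : ℕ in atTop, gridState G h n x₀ ((m + 1 : ℕ) : ℝ≥0)⁻¹ (k * (m + 1)) = x k := by
  set T : Set ℝ≥0 := ⋃ i, {t | t ≤ k ∧ TicksAt (n i) t} with hT
  have hfin : T.Finite := Set.finite_iUnion fun i => (hn i).finite_ticks k
  have hlim : Tendsto (fun m : ℕ => ((m + 1 : ℕ) : ℝ≥0)⁻¹) atTop (𝓝 0) :=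
    tendsto_inv_atTop_zero.comp (tendsto_natCast_atTop_atTop.comp (tendsto_add_atTop_nat 1))
  have hsep : ∀ᶠ m : ℕ in atTop, ∀ s ∈ T, ∀ t ∈ T, s < t → s + ((m + 1 : ℕ) : ℝ≥0)⁻¹ < t := by
    rw [eventually_all_finite hfin]
    intro s _
    rw [eventually_all_finite hfin]
    intro t _
    by_cases hst : s < t
    · have : Tendsto (fun m : ℕ => s + ((m + 1 : ℕ) : ℝ≥0)⁻¹) atTop (𝓝 (s + 0)) :=
        hlim.const_add s
      rw [add_zero] at this
      filter_upwards [this.eventually_lt_const hst] with m hm _ using hm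
    · exact Eventually.of_forall fun m h => absurd h hst
  filter_upwards [hsep] with m hm
  set δ : ℝ≥0 := ((m + 1 : ℕ) : ℝ≥0)⁻¹ with hδ
  have hm1 : ((m + 1 : ℕ) : ℝ≥0) ≠ 0 := by positivity
  have hend : ((k * (m + 1) : ℕ) : ℝ≥0) * δ = k := by
    rw [Nat.cast_mul, hδ, mul_assoc, mul_inv_cancel₀ hm1, mul_one]
  have key : ∀ j : ℕ, j ≤ k * (m + 1) → gridState G h n x₀ δ j = x (j * δ) := by
    intro j
    induction j with
    | zero => intro _; simp [gridState, hx.init]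
    | succ j ih =>
      intro hj
      funext i
      have hle : ((j + 1 : ℕ) : ℝ≥0) * δ ≤ k := by
        rw [← hend]; gcongr
      have hadd : ((j + 1 : ℕ) : ℝ≥0) * δ = j * δ + δ := by push_cast; ring
      rw [hx.step_of_subsingleton hn (a := j * δ) (b := (j + 1 : ℕ) * δ) (by rw [hadd]; simp) ?_ i]
      · simp only [gridState]
        rw [ih (by omega)]
      · have aux : ∀ i j', ∀ s ∈ Set.Ioc ((j : ℝ≥0) * δ) ((j + 1 : ℕ) * δ),
            ∀ t ∈ Set.Ioc ((j : ℝ≥0) * δ) ((j + 1 : ℕ) * δ), TicksAt (n i) s →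
            TicksAt (n j') t → ¬ s < t := by
          intro i j' s hs t ht h1 h2 hlt
          have := hm s (Set.mem_iUnion.2 ⟨i, hs.2.trans hle, h1⟩) t
            (Set.mem_iUnion.2 ⟨j', ht.2.trans hle, h2⟩) hlt
          have h3 : ((j + 1 : ℕ) : ℝ≥0) * δ < s + δ := by
            rw [hadd]; exact add_lt_add_left hs.1 δ
          exact absurd (this.trans_le (ht.2.trans h3.le)) (lt_irrefl _)
        intro i j' s hs t ht h1 h2
        exact le_antisymm (not_lt.1 (aux j' i t ht s hs h2 h1)) (not_lt.1 (aux i j' s hs t ht h1 h2))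
  rw [key _ le_rfl, hend]

end Grid

section Measurability

variable {V Ω : Type*} [Fintype V] [MeasurableSpace Ω]

theorem measurable_lastTick {N : ℝ≥0 → Ω → ℕ} {t : ℝ≥0} (hN : ∀ s ≤ t, Measurable (N s)) :
    Measurable fun ω => lastTick (fun s => N s ω) t := by
  unfold lastTick
  refine Measurable.iInf fun m => Measurable.ite ?_ measurable_const measurable_const
  exact measurableSet_eq_fun (hN _ (min_le_right _ _)) (hN t le_rfl)

theorem Network.measurableSet_update_eq (G : Network V) (x : Config V) (i : V) (v : ℤˣ) :
    MeasurableSet {f : V → ℝ | G.update f x i = v} := by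
  have h1 : MeasurableSet {f : V → ℝ | 0 < ∑ j, G.weight i j * ((x j : ℤ) : ℝ) + f i} :=
    measurableSet_lt measurable_const (measurable_const.add (measurable_pi_apply i))
  have h2 : MeasurableSet {f : V → ℝ | ∑ j, G.weight i j * ((x j : ℤ) : ℝ) + f i < 0} :=
    measurableSet_lt (measurable_const.add (measurable_pi_apply i)) measurable_const
  have heq : {f : V → ℝ | G.update f x i = v} =
      ({f | 0 < ∑ j, G.weight i j * ((x j : ℤ) : ℝ) + f i} ∩ {_f | 1 = v}) ∪
      ({f | 0 < ∑ j, G.weight i j * ((x j : ℤ) : ℝ) + f i}ᶜ ∩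
        (({f | ∑ j, G.weight i j * ((x j : ℤ) : ℝ) + f i < 0} ∩ {_f | -1 = v}) ∪
        ({f | ∑ j, G.weight i j * ((x j : ℤ) : ℝ) + f i < 0}ᶜ ∩ {_f | x i = v}))) := by
    ext f
    simp only [Network.update, Set.mem_ofPred_eq, Set.mem_union, Set.mem_inter_iff,
      Set.mem_compl_iff]
    split_ifs with h1 h2
    · simp [h1]
    · simp [h1, h2]
    · simp [h1, h2]
  rw [heq]
  exact (h1.inter (MeasurableSet.const _)).union (h1.compl.inter
    ((h2.inter (MeasurableSet.const _)).union (h2.compl.inter (MeasurableSet.const _))))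

/-- Measurability of the clocks is required only up to `t`, so that the σ-algebra may be that of the
past. -/
theorem measurableSet_gridState_eq (G : Network V) {h : ℝ≥0 → V → ℝ} (hh : Measurable h)
    {N : V → ℝ≥0 → Ω → ℕ} (x₀ : Config V) {t : ℝ≥0} (hN : ∀ i, ∀ s ≤ t, Measurable (N i s))
    (δ : ℝ≥0) (j : ℕ) (hj : j * δ ≤ t) (z : Config V) :
    MeasurableSet {ω | gridState G h (fun i s => N i s ω) x₀ δ j = z} := by
  induction j generalizing z with
  | zero => exact MeasurableSet.const (x₀ = z)
  | succ j ih =>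
    have hle : (j : ℝ≥0) * δ ≤ (j + 1 : ℕ) * δ := by gcongr; simp
    have heq : {ω | gridState G h (fun i s => N i s ω) x₀ δ (j + 1) = z} =
        ⋃ y : Config V, {ω | gridState G h (fun i s => N i s ω) x₀ δ j = y} ∩
          ⋂ i, (({ω | N i (j * δ) ω < N i ((j + 1 : ℕ) * δ) ω} ∩
              {ω | G.update (h (lastTick (fun s => N i s ω) ((j + 1 : ℕ) * δ))) y i = z i}) ∪
            ({ω | N i (j * δ) ω < N i ((j + 1 : ℕ) * δ) ω}ᶜ ∩ {_ω | y i = z i})) := by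
      ext ω
      simp only [gridState, Set.mem_ofPred_eq, Set.mem_iUnion, Set.mem_inter_iff, Set.mem_iInter,
        Set.mem_union, Set.mem_compl_iff, exists_eq_left']
      rw [funext_iff]
      refine forall_congr' fun i => ?_
      split_ifs with hlt
      · simp only [hlt, true_and, not_true_eq_false, false_and, or_false]
      · simp only [hlt, false_and, not_false_eq_true, true_and, false_or]
    rw [heq]
    refine MeasurableSet.iUnion fun y => (ih (hle.trans hj) y).inter
      (MeasurableSet.iInter fun i => ?_)
    have h1 : MeasurableSet {ω | N i (j * δ) ω < N i ((j + 1 : ℕ) * δ) ω} :=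
      measurableSet_lt (hN i _ (hle.trans hj)) (hN i _ hj)
    have h2 := (hh.comp (measurable_lastTick fun s hs => hN i s (hs.trans hj)))
      (G.measurableSet_update_eq y i (z i))
    exact (h1.inter h2).union (h1.compl.inter (MeasurableSet.const _))

/-- The event that the discretisations of the dynamics at time `k` settle on `z`. -/
def settledEvent (G : Network V) (h : ℝ≥0 → V → ℝ) (N : V → ℝ≥0 → Ω → ℕ) (x₀ : Config V)
    (z : Config V) (k : ℕ) : Set Ω :=
  {ω | ∀ᶠ m : ℕ in atTop,
    gridState G h (fun i s => N i s ω) x₀ ((m + 1 : ℕ) : ℝ≥0)⁻¹ (k * (m + 1)) = z}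

theorem measurableSet_settledEvent (G : Network V) {h : ℝ≥0 → V → ℝ} (hh : Measurable h)
    {N : V → ℝ≥0 → Ω → ℕ} (x₀ z : Config V) {k : ℕ}
    (hN : ∀ i, ∀ s ≤ (k : ℝ≥0), Measurable (N i s)) :
    MeasurableSet (settledEvent G h N x₀ z k) := by
  have heq : settledEvent G h N x₀ z k = liminf (fun m : ℕ => {ω |
      gridState G h (fun i s => N i s ω) x₀ ((m + 1 : ℕ) : ℝ≥0)⁻¹ (k * (m + 1)) = z}) atTop := by
    ext ω
    rw [mem_liminf_iff_eventually_mem]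
    rfl
  rw [heq]
  refine MeasurableSet.measurableSet_liminf fun m =>
    measurableSet_gridState_eq G hh x₀ hN _ _ (le_of_eq ?_) z
  have hm1 : ((m + 1 : ℕ) : ℝ≥0) ≠ 0 := by positivity
  rw [Nat.cast_mul, mul_assoc, mul_inv_cancel₀ hm1, mul_one]

omit [MeasurableSpace Ω] in
-- No measurability of `X` is assumed; along good paths this replaces `X k = z` by an event of the
-- clocks up to time `k`.
theorem IsLTDPath.mem_settledEvent_iff {G : Network V} {h : ℝ≥0 → V → ℝ} {N : V → ℝ≥0 → Ω → ℕ}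
    {x₀ : Config V} {x : ℝ≥0 → Config V} {ω : Ω}
    (hx : IsLTDPath G h (fun i s => N i s ω) x₀ x)
    (hn : ∀ i, IsCountingPath fun s => N i s ω) (z : Config V) (k : ℕ) :
    ω ∈ settledEvent G h N x₀ z k ↔ x k = z := by
  have hev := hx.eventually_gridState_eq hn k
  refine ⟨fun hω => ?_, fun hz => hz ▸ hev⟩
  obtain ⟨m, hm1, hm2⟩ := (hev.and hω).exists
  exact hm1.symm.trans hm2

end Measurability

/-! ### Independence of past and future ticks, and Borel-Cantelli -/

/-- Puts finitely many past times, `r` and `t` on one monotone sequence, as independence of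
increments requires; repetitions do no harm. -/
theorem exists_monotone_enumeration (I : Finset ℝ≥0) {r t : ℝ≥0} (hI : ∀ s ∈ I, s ≤ r)
    (hrt : r ≤ t) : ∃ (τ : ℕ → ℝ≥0) (m : ℕ), Monotone τ ∧ τ 0 = 0 ∧ τ m = r ∧ τ (m + 1) = t ∧
      ∀ s ∈ I, ∃ j ≤ m, τ j = s := by
  refine ⟨fun n => if n = 0 then 0 else if hn : n - 1 < I.card then
    I.orderEmbOfFin rfl ⟨n - 1, hn⟩ else if n = I.card + 1 then r else t, I.card + 1, ?_, ?_, ?_,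
    ?_, ?_⟩
  · refine monotone_nat_of_le_succ fun n => ?_
    by_cases h0 : n = 0
    · simp [h0]
    · have h0' : n + 1 ≠ 0 := by omega
      simp only [h0, h0', if_false]
      by_cases h1 : n + 1 - 1 < I.card
      · have h2 : n - 1 < I.card := by omega
        rw [dif_pos h1, dif_pos h2]
        exact (I.orderEmbOfFin rfl).monotone (by simp)
      · rw [dif_neg h1]
        by_cases h2 : n - 1 < I.card
        · rw [dif_pos h2]
          have := hI _ (I.orderEmbOfFin_mem rfl ⟨n - 1, h2⟩)
          split_ifs
          exacts [this, this.trans hrt]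
        · rw [dif_neg h2]
          have h3 : n + 1 ≠ I.card + 1 := by omega
          rw [if_neg h3]
          split_ifs
          exacts [hrt, le_rfl]
  · simp
  · simp
  · simp
  · intro s hs
    have : s ∈ Set.range (I.orderEmbOfFin rfl) := by rw [Finset.range_orderEmbOfFin]; exact hs
    obtain ⟨j, rfl⟩ := this
    exact ⟨j + 1, by omega, by simp⟩

section Independence

variable {Ω : Type*} [MeasurableSpace Ω] {P : Measure Ω}

theorem IsPoissonClock.ae_isCountingPath {N : ℝ≥0 → Ω → ℕ} (hN : IsPoissonClock N P) :
    ∀ᵐ ω ∂P, IsCountingPath fun t => N t ω := by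
  filter_upwards [hN.zero, hN.mono, hN.right_continuous] with ω h1 h2 h3 using ⟨h1, h2, h3⟩

/-- The increments of a Poisson clock after time `r` are independent of its path up to `r`. -/
theorem IsPoissonClock.indepFun_past_increment [IsProbabilityMeasure P] {N : ℝ≥0 → Ω → ℕ}
    (hN : IsPoissonClock N P) {r t : ℝ≥0} (hrt : r ≤ t) :
    IndepFun (fun ω (s : Set.Iic r) => N s ω) (fun ω => N t ω - N r ω) P := by
  classical
  refine IndepFun.process_indepFun (fun s => hN.measurable s)
    ((hN.measurable t).sub (hN.measurable r)) fun I => ?_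
  obtain ⟨τ, m, hτ, hτ0, hτm, hτm1, hI⟩ := exists_monotone_enumeration
    (I.image Subtype.val) (r := r) (t := t)
    (fun s hs => by
      obtain ⟨u, _, rfl⟩ := Finset.mem_image.1 hs
      exact u.2) hrt
  choose j hjm hj using fun s : I => hI s.1.1 (Finset.mem_image_of_mem _ s.2)
  have hind := (hN.indep_increments.nat hτ).indepFun_finset (Finset.range m) {m} (by simp)
    fun k => (hN.measurable _).sub (hN.measurable _)
  -- As the clock starts at zero, its value at `τ (j s)` is the sum of the first `j s` increments.
  -- Since `j s ≤ m`, the default `0` is never used; increment `m` runs from `r` to `t`.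
  have hcomp := hind.comp
    (φ := fun (d : Finset.range m → ℕ) (s : I) =>
      ∑ k : Finset.range (j s), if h : (k : ℕ) < m then d ⟨k, Finset.mem_range.2 h⟩ else 0)
    (ψ := fun d : ({m} : Finset ℕ) → ℕ => d ⟨m, Finset.mem_singleton_self m⟩)
    Measurable.of_discrete Measurable.of_discrete
  refine hcomp.congr ?_ ?_
  · filter_upwards [hN.zero, hN.mono] with ω h0 hmono
    funext s
    have h1 : ∀ k : Finset.range (j s), (k : ℕ) < m := fun k =>
      (Finset.mem_range.1 k.2).trans_le (hjm s)
    simp only [Function.comp_apply, h1, dif_pos]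
    rw [Finset.sum_coe_sort (Finset.range (j s)) fun k => N (τ (k + 1)) ω - N (τ k) ω,
      Finset.sum_range_tsub (f := fun k => N (τ k) ω) (hmono.comp hτ), hτ0, h0, hj]
    rfl
  · refine Eventually.of_forall fun ω => ?_
    simp [hτm, hτm1]

/-- The information carried by the clocks up to time `t`. -/
abbrev pastClocks {V : Type*} (N : V → ℝ≥0 → Ω → ℕ) (t : ℝ≥0) : MeasurableSpace Ω :=
  MeasurableSpace.comap (fun ω (i : V) (s : Set.Iic t) => N i s ω) inferInstance

omit [MeasurableSpace Ω] in
theorem measurable_pastClocks {V : Type*} (N : V → ℝ≥0 → Ω → ℕ) {s t : ℝ≥0} (hst : s ≤ t)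
    (i : V) : Measurable[pastClocks N t] (N i s) :=
  Measurable.comp (g := fun f : V → Set.Iic t → ℕ => f i ⟨s, hst⟩)
    ((measurable_pi_apply (⟨s, hst⟩ : Set.Iic t)).comp (measurable_pi_apply i))
    (comap_measurable fun ω (i : V) (s : Set.Iic t) => N i s ω)

theorem pastClocks_le {V : Type*} {N : V → ℝ≥0 → Ω → ℕ} (hN : ∀ i s, Measurable (N i s))
    (t : ℝ≥0) : pastClocks N t ≤ ‹MeasurableSpace Ω› :=
  Measurable.comap_le <| measurable_pi_lambda _ fun i => measurable_pi_lambda _ fun s => hN i s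

omit [MeasurableSpace Ω] in
theorem pastClocks_mono {V : Type*} (N : V → ℝ≥0 → Ω → ℕ) : Monotone (pastClocks N) := by
  intro s t hst
  refine Measurable.comap_le (@measurable_pi_lambda _ _ _ (pastClocks N t) _ _ fun i =>
    @measurable_pi_lambda _ _ _ (pastClocks N t) _ _ fun u =>
      measurable_pastClocks N (u.2.trans hst) i)

theorem iIndepFun_bool_of_indepFun [IsProbabilityMeasure P] {E : Type*} [MeasurableSpace E]
    {Y : Bool → Ω → E} (h : IndepFun (Y true) (Y false) P) : iIndepFun Y P := by
  rw [iIndepFun_iff_measure_inter_preimage_eq_mul]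
  intro S sets hS
  have hcases : ∀ S : Finset Bool, S = ∅ ∨ S = {true} ∨ S = {false} ∨ S = {true, false} := by
    decide
  rcases hcases S with rfl | rfl | rfl | rfl
  · simp
  · simp
  · simp
  · rw [Finset.prod_pair (by decide)]
    simp only [Finset.mem_insert, Finset.mem_singleton, Set.iInter_iInter_eq_or_left,
      Set.iInter_iInter_eq_left]
    exact h.measure_inter_preimage_eq_mul _ _ (hS true (by simp)) (hS false (by simp))

variable {V : Type*} [Fintype V]

theorem indepFun_pastClocks_increments [IsProbabilityMeasure P] {N : V → ℝ≥0 → Ω → ℕ}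
    (hclock : ∀ i, IsPoissonClock (N i) P) (hind : iIndepFun (fun i ω t => N i t ω) P)
    {r t : ℝ≥0} (hrt : r ≤ t) :
    IndepFun (fun ω (i : V) (s : Set.Iic r) => N i s ω) (fun ω i => N i t ω - N i r ω) P := by
  classical
  -- Past and increment must take values in the same space to form one family indexed by `V × Bool`,
  -- so the increment is stored as a constant function.
  set Y : V → Bool → Ω → (Set.Iic r → ℕ) := fun i b ω s =>
    if b then N i s ω else N i t ω - N i r ω with hY
  have hmeas : ∀ i b, Measurable (Y i b) := by
    intro i b
    refine measurable_pi_lambda _ fun s => ?_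
    cases b
    · exact ((hclock i).measurable t).sub ((hclock i).measurable r)
    · simpa [hY] using (hclock i).measurable s
  have h1 : iIndepFun (fun i ω b => Y i b ω) P := by
    refine hind.comp (fun i (c : ℝ≥0 → ℕ) (b : Bool) (s : Set.Iic r) =>
      if b then c s else c t - c r) fun i => ?_
    refine measurable_pi_lambda _ fun b => measurable_pi_lambda _ fun s => ?_
    cases b
    · exact (measurable_pi_apply t).sub (measurable_pi_apply r)
    · simpa using measurable_pi_apply (s : ℝ≥0)
  have h2 : ∀ i, iIndepFun (Y i) P := fun i => iIndepFun_bool_of_indepFun <| by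
    have := ((hclock i).indepFun_past_increment hrt).comp
      (φ := id) (ψ := fun d (_ : Set.Iic r) => d) measurable_id
      (measurable_pi_lambda _ fun _ => measurable_id)
    simpa [hY, Function.comp_def] using this
  have h3 := (iIndepFun_uncurry' hmeas h1 h2).indepFun_finset
    (Finset.univ.filter fun p => p.2 = true) (Finset.univ.filter fun p => p.2 = false)
    (by rw [Finset.disjoint_filter]; intro p _ h; simp [h]) fun p => hmeas p.1 p.2
  have h4 := h3.comp
    (φ := fun d (i : V) (s : Set.Iic r) => d ⟨(i, true), by simp⟩ s)
    (ψ := fun d (i : V) => d ⟨(i, false), by simp⟩ ⟨0, Set.mem_Iic.2 zero_le⟩)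
    (measurable_pi_lambda _ fun i => measurable_pi_lambda _ fun s =>
      (measurable_pi_apply s).comp (measurable_pi_apply _))
    (measurable_pi_lambda _ fun i =>
      (measurable_pi_apply _).comp (measurable_pi_apply _))
  simpa [hY, Function.comp_def] using h4

/-- The event that in `(k, k + 1]` the ticking clocks are exactly those of the nodes in `B`. -/
def tickEvent (N : V → ℝ≥0 → Ω → ℕ) (B : Set V) (k : ℕ) : Set Ω :=
  {ω | ∀ i, N i k ω < N i (k + 1 : ℕ) ω ↔ i ∈ B}

omit [MeasurableSpace Ω] [Fintype V] in
theorem tickEvent_eq_iInter (N : V → ℝ≥0 → Ω → ℕ) (B : Set V) (k : ℕ) :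
    tickEvent N B k = ⋂ i, (fun ω => N i (k + 1 : ℕ) ω - N i k ω) ⁻¹' {d | 0 < d ↔ i ∈ B} := by
  ext ω
  simp [tickEvent]

omit [Fintype V] in
theorem poissonMeasure_one_real_pos (B : Set V) (i : V) :
    0 < (poissonMeasure 1).real {d | 0 < d ↔ i ∈ B} := by
  by_cases hi : i ∈ B
  · refine (poissonMeasure_real_singleton_pos 1 one_pos).trans_le (measureReal_mono ?_)
    simp [hi]
  · refine (poissonMeasure_real_singleton_pos 0 one_pos).trans_le (measureReal_mono ?_)
    simp [hi]

/-- The right-hand side does not depend on `k`: this is the constant probability that Borel-Cantelli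
needs. -/
theorem measureReal_tickEvent {N : V → ℝ≥0 → Ω → ℕ}
    (hclock : ∀ i, IsPoissonClock (N i) P) (hind : iIndepFun (fun i ω t => N i t ω) P)
    (B : Set V) (k : ℕ) :
    P.real (tickEvent N B k) = ∏ i, (poissonMeasure 1).real {d | 0 < d ↔ i ∈ B} := by
  have h1 : iIndepFun (fun i ω => N i (k + 1 : ℕ) ω - N i k ω) P :=
    hind.comp (fun i (c : ℝ≥0 → ℕ) => c (k + 1 : ℕ) - c k) fun i =>
      (measurable_pi_apply _).sub (measurable_pi_apply _)
  rw [tickEvent_eq_iInter, measureReal_def,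
    h1.meas_iInter (fun i => ⟨_, MeasurableSet.of_discrete, rfl⟩), ENNReal.toReal_prod]
  refine Finset.prod_congr rfl fun i _ => ?_
  have hlaw := (hclock i).law_increments k (k + 1 : ℕ) (by simp)
  have hone : ((k + 1 : ℕ) : ℝ≥0) - k = 1 := by simp
  rw [hone] at hlaw
  exact hlaw.measureReal_eq (p := fun d => 0 < d ↔ i ∈ B) MeasurableSet.of_discrete

/-- Lévy's form of the second Borel-Cantelli lemma for events `E k` of the past and events `A k`
which are independent of the past and have a constant positive probability. -/
theorem ae_frequently_mem_inter [IsProbabilityMeasure P] {ℱ : Filtration ℕ ‹MeasurableSpace Ω›}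
    {E A : ℕ → Set Ω} (hE : ∀ k, MeasurableSet[ℱ k] (E k))
    (hA : ∀ k, MeasurableSet[ℱ (k + 1)] (A k)) {m' : ℕ → MeasurableSpace Ω}
    (hm' : ∀ k, m' k ≤ ‹MeasurableSpace Ω›) (hAm' : ∀ k, MeasurableSet[m' k] (A k))
    (hind : ∀ k, Indep (m' k) (ℱ k) P) {p : ℝ} (hp : 0 < p) (hpA : ∀ k, P.real (A k) = p) :
    ∀ᵐ ω ∂P, (∃ᶠ k in atTop, ω ∈ E k) → ∃ᶠ k in atTop, ω ∈ E k ∩ A k := by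
  -- The shift by one makes the events adapted: `E k ∩ A k` is known only at time `k + 1`.
  set s : ℕ → Set Ω := fun k => Nat.casesOn k ∅ fun k => E k ∩ A k with hs
  have hsm : ∀ k, MeasurableSet[ℱ k] (s k) := by
    intro k
    cases k with
    | zero => exact @MeasurableSet.empty Ω (ℱ 0)
    | succ k => exact (ℱ.mono k.le_succ _ (hE k)).inter (hA k)
  have hcond : ∀ k, P[(s (k + 1)).indicator (1 : Ω → ℝ) | ℱ k] =ᵐ[P]
      (E k).indicator fun _ => p := by
    intro k
    have hEm := ℱ.le k _ (hE k)
    have hAm := ℱ.le (k + 1) _ (hA k)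
    have hfun : (s (k + 1)).indicator (1 : Ω → ℝ) =
        (E k).indicator (1 : Ω → ℝ) * (A k).indicator (1 : Ω → ℝ) :=
      Set.inter_indicator_one
    have hintA : Integrable ((A k).indicator (1 : Ω → ℝ)) P :=
      (integrable_const (1 : ℝ)).indicator hAm
    have hprod : Integrable ((E k).indicator (1 : Ω → ℝ) * (A k).indicator (1 : Ω → ℝ)) P := by
      rw [← hfun]
      exact (integrable_const (1 : ℝ)).indicator (hEm.inter hAm)
    rw [hfun]
    have h1 := condExp_mul_of_stronglyMeasurable_left (m := ℱ k) (μ := P)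
      ((@stronglyMeasurable_one Ω ℝ (ℱ k) _ _).indicator (hE k)) hprod hintA
    have h2 := condExp_indep_eq (hm' k) (ℱ.le k) (μ := P) (f := (A k).indicator (1 : Ω → ℝ))
      ((@stronglyMeasurable_one Ω ℝ (m' k) _ _).indicator (hAm' k)) (hind k)
    filter_upwards [h1, h2] with ω h1 h2
    rw [h1, Pi.mul_apply, h2, integral_indicator_one hAm, hpA]
    by_cases hω : ω ∈ E k <;> simp [hω]
  filter_upwards [ae_mem_limsup_atTop_iff P hsm, ae_all_iff.2 hcond] with ω h1 h2 hfreq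
  have h3 : ω ∈ limsup E atTop := by rwa [mem_limsup_iff_frequently_mem]
  -- The conditional probabilities are `p` on `E k` and `0` elsewhere, so their sum diverges exactly
  -- when infinitely many `E k` occur.
  rw [Set.limsup_eq_tendsto_sum_indicator_atTop hp E] at h3
  have h4 : ω ∈ limsup s atTop := h1.2 (by
    simp only [h2]
    exact h3)
  rw [mem_limsup_iff_frequently_mem, ← map_add_atTop_eq_nat 1, frequently_map] at h4
  exact h4

/-- If the dynamics is in `z` at infinitely many times in `K`, then at infinitely many of these
the clocks ticking in the following unit of time are exactly those of `B`. -/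
theorem IsATVLTD.ae_frequently_tickEvent [IsProbabilityMeasure P] {G : Network V}
    {h : ℝ≥0 → V → ℝ} (hh : Measurable h) {x₀ : Config V} {N : V → ℝ≥0 → Ω → ℕ}
    {X : ℝ≥0 → Ω → Config V} (hX : IsATVLTD G h x₀ N X P) (K : Set ℕ) :
    ∀ᵐ ω ∂P, ∀ (z : Config V) (B : Set V), (∃ᶠ k : ℕ in atTop, k ∈ K ∧ X k ω = z) →
      ∃ᶠ k : ℕ in atTop, (k ∈ K ∧ X k ω = z) ∧ ω ∈ tickEvent N B k := by
  have hmeas : ∀ i s, Measurable (N i s) := fun i => (hX.clock i).measurable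
  let ℱ : Filtration ℕ ‹MeasurableSpace Ω› :=
    { seq := fun k => pastClocks N k
      mono' := fun k l hkl => pastClocks_mono N (by exact_mod_cast hkl)
      le' := fun k => pastClocks_le hmeas k }
  have key : ∀ (z : Config V) (B : Set V), ∀ᵐ ω ∂P,
      (∃ᶠ k in atTop, ω ∈ {_ω | k ∈ K} ∩ settledEvent G h N x₀ z k) →
      ∃ᶠ k in atTop, ω ∈ ({_ω | k ∈ K} ∩ settledEvent G h N x₀ z k) ∩ tickEvent N B k := by
    intro z B
    refine ae_frequently_mem_inter (ℱ := ℱ) (E := fun k => {_ω | k ∈ K} ∩ settledEvent G h N x₀ z k)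
      (m' := fun k => MeasurableSpace.comap (fun ω i => N i (k + 1 : ℕ) ω - N i k ω) inferInstance)
      (fun k => ?_) (fun k => ?_)
      (fun k => ?_) (fun k => ?_) (fun k => ?_)
      (Finset.prod_pos fun i _ => poissonMeasure_one_real_pos B i)
      (measureReal_tickEvent hX.clock hX.indep B)
    · exact (MeasurableSet.const _).inter (@measurableSet_settledEvent V Ω _ (pastClocks N k) G h hh
        N x₀ z k fun i s hs => measurable_pastClocks N hs i)
    · rw [tickEvent_eq_iInter]
      refine MeasurableSet.iInter fun i => ?_
      exact (Measurable.sub (measurable_pastClocks N le_rfl i)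
        (measurable_pastClocks N (by simp) i)) MeasurableSet.of_discrete
    · exact (measurable_pi_lambda _ fun i => (hmeas i _).sub (hmeas i _)).comap_le
    · refine ⟨{d | ∀ i, 0 < d i ↔ i ∈ B}, ?_, ?_⟩
      · rw [Set.ofPred_forall]
        exact MeasurableSet.iInter fun i => (measurable_pi_apply (X := fun _ : V => ℕ) i)
          (MeasurableSet.of_discrete (s := {d : ℕ | 0 < d ↔ i ∈ B}))
      · ext ω
        simp [tickEvent]
    · exact (indepFun_pastClocks_increments hX.clock hX.indep (by simp)).symm
  filter_upwards [ae_all_iff.2 fun z => ae_all_iff.2 (key z), hX.path,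
    ae_all_iff.2 fun i => (hX.clock i).ae_isCountingPath] with ω h1 hpath hcount z B hfreq
  have hiff := hpath.mem_settledEvent_iff hcount z
  refine (h1 z B (hfreq.mono fun k hk => ⟨hk.1, (hiff k).2 hk.2⟩)).mono fun k hk => ?_
  exact ⟨⟨hk.1.1, (hiff k).1 hk.1.2⟩, hk.2⟩

end Independence

/-! ### Recurrence and absorption of consensus -/

section Consensus

variable {V : Type*} [Fintype V]

namespace IsLTDPath

variable {G : Network V} {h : ℝ≥0 → V → ℝ} {n : V → ℝ≥0 → ℕ} {x₀ : Config V}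
  {x : ℝ≥0 → Config V} {hm hp : V → ℝ}

open Classical in
/-- The consensus on `a` is absorbing if no node ever leaves it. -/
theorem eq_const_of_le (hx : IsLTDPath G h n x₀ x) (hh : ∀ t, h t ∈ Set.Icc hm hp) {a : ℤˣ}
    (ha : ∀ i, -((a : ℤ) : ℝ) * signField hm hp (-a) i < G.outDegree i) {s t : ℝ≥0} (hst : s ≤ t)
    (hs : x s = fun _ => a) : x t = fun _ => a := by
  refine hx.invariant (fun c => c = fun _ => a) hs (fun t _ y z hy hz => ?_) t ⟨hst, le_rfl⟩
  subst hy
  funext i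
  rw [hz i, ite_eq_right_iff]
  intro _
  refine Network.Attracted.update_eq ?_ (hh t)
  unfold Network.Attracted
  rw [G.drive_const, ← mul_assoc, cast_units_mul_self]
  linarith [ha i]

open Classical in
/-- A node that prefers `a` under all fields is in the state `a` from its first tick on. -/
theorem eq_of_stubborn (hx : IsLTDPath G h n x₀ x) (hn : ∀ i, IsCountingPath (n i))
    (hh : ∀ t, h t ∈ Set.Icc hm hp) {a : ℤˣ} {i : V}
    (hi : G.outDegree i < ((a : ℤ) : ℝ) * signField hm hp (-a) i) {r s t : ℝ≥0}
    (hrs : n i r < n i s) (hst : s ≤ t) : x t i = a := by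
  have hupd : ∀ t (y : Config V), G.update (h t) y i = a := by
    intro t y
    refine Network.Attracted.update_eq ?_ (hh t)
    have := G.neg_outDegree_le_mul_drive y a i
    unfold Network.Attracted
    linarith
  obtain ⟨u, hu, htick⟩ := (hn i).exists_tick hrs
  obtain ⟨y, -, hy⟩ := hx.step u htick.1
  refine hx.invariant (fun c => c i = a) (a := u) ?_ (fun t _ y z hy hz => ?_) t
    ⟨hu.2.trans hst, le_rfl⟩
  · rw [hy i, if_pos htick, hupd]
  · rw [hz i]
    split_ifs
    exacts [hupd t y, hy]

end IsLTDPath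

theorem exists_frequently_eq (x : ℝ≥0 → Config V) {K : Set ℕ} (hK : ∃ᶠ k in atTop, k ∈ K) :
    ∃ z, ∃ᶠ k : ℕ in atTop, k ∈ K ∧ x k = z := by
  by_contra hne
  push Not at hne
  refine hK ?_
  have := eventually_all.2 hne
  filter_upwards [this] with k hk hkK
  exact hk (x k) hkK rfl

namespace IsATVLTD

variable {Ω : Type*} [MeasurableSpace Ω] {P : Measure Ω} [IsProbabilityMeasure P]
  {G : Network V} {h : ℝ≥0 → V → ℝ} {x₀ : Config V} {N : V → ℝ≥0 → Ω → ℕ}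
  {X : ℝ≥0 → Ω → Config V}

/-- Configurations that can be reached, by moves valid for the fields occurring after the times in
`K`, from one visited at infinitely many times in `K` are also visited at infinitely many times
in `K`. -/
theorem ae_frequently_of_reach (hX : IsATVLTD G h x₀ N X P) (hh : Measurable h)
    {𝓗 : Set (V → ℝ)} {K K' : Set ℕ} (hK : ∀ k ∈ K, k + 1 ∈ K') (hK' : ∀ k ∈ K', k + 1 ∈ K)
    (hfield : ∀ k ∈ K, ∀ t ∈ Set.Ioc (k : ℝ≥0) (k + 1 : ℕ), h t ∈ 𝓗) :
    ∀ᵐ ω ∂P, ∀ z z', Relation.ReflTransGen (G.Move 𝓗) z z' →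
      (∃ᶠ k : ℕ in atTop, k ∈ K ∧ X k ω = z) → ∃ᶠ k : ℕ in atTop, k ∈ K ∧ X k ω = z' := by
  filter_upwards [hX.ae_frequently_tickEvent hh K, hX.ae_frequently_tickEvent hh K', hX.path,
    ae_all_iff.2 fun i => (hX.clock i).ae_isCountingPath] with ω h1 h2 hpath hcount z z' hreach hz
  induction hreach with
  | refl => exact hz
  | @tail y y' _ hmove ih =>
    obtain ⟨i, hoff, hi⟩ := hmove
    -- A move takes two units of time: in the first, starting in `K`, only `i` ticks and the field
    -- lies in `𝓗`; the second, starting in `K'`, is idle and leads back to `K`.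
    have hnext : ∃ᶠ k : ℕ in atTop, k ∈ K' ∧ X k ω = y' := by
      rw [← map_add_atTop_eq_nat 1, frequently_map]
      refine (h1 y {i} ih).mono fun k hk => ⟨hK k hk.1.1, ?_⟩
      refine hpath.eq_of_single_tick hcount (a := k) (i := i) (fun j => hk.2 j) ?_ ?_
      · simpa only [hk.1.2] using hoff
      · intro t ht
        simpa only [hk.1.2] using hi _ (hfield k hk.1.1 t ht)
    rw [← map_add_atTop_eq_nat 1, frequently_map]
    refine (h2 y' ∅ hnext).mono fun k hk => ⟨hK' k hk.1.1, ?_⟩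
    rw [← hk.1.2]
    refine hpath.eq_of_no_tick (by simp) fun j t ht htick => ?_
    exact (hk.2 j).1 ((hcount j).lt_of_tick ht htick)

theorem ae_frequently_consensus (hX : IsATVLTD G h x₀ N X P) (hh : Measurable h)
    {hm hp : V → ℝ} (hle : hm ≤ hp) (hind : G.Indecomposable hm hp)
    (hIcc : ∀ t, h t ∈ Set.Icc hm hp) :
    ∀ᵐ ω ∂P, ∃ a : ℤˣ, ∃ᶠ k : ℕ in atTop, X k ω = fun _ => a := by
  filter_upwards [hX.ae_frequently_of_reach hh (K := Set.univ) (K' := Set.univ)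
    (fun _ _ => trivial) (fun _ _ => trivial) (fun _ _ t _ => hIcc t)] with ω hω
  obtain ⟨z, hz⟩ := exists_frequently_eq (fun t => X t ω) (K := Set.univ)
    (Eventually.of_forall fun _ => trivial).frequently
  rcases hind.reach_consensus hle 1 z with hr | hr
  exacts [⟨1, (hω _ _ hr hz).mono fun k hk => hk.2⟩, ⟨-1, (hω _ _ hr hz).mono fun k hk => hk.2⟩]

theorem ae_frequently_const (hX : IsATVLTD G h x₀ N X P) (hh : Measurable h)
    {hm hp : V → ℝ} (hle : hm ≤ hp) (hind : G.Indecomposable hm hp) {a : ℤˣ} {i : V}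
    (hi : G.outDegree i < ((a : ℤ) : ℝ) * signField hm hp a i) {K K' : Set ℕ}
    (hK : ∀ k ∈ K, k + 1 ∈ K') (hK' : ∀ k ∈ K', k + 1 ∈ K) (hne : K.Nonempty)
    (hfield : ∀ k ∈ K, ∀ t ∈ Set.Ioc (k : ℝ≥0) (k + 1 : ℕ), h t = signField hm hp a) :
    ∀ᵐ ω ∂P, ∃ᶠ k : ℕ in atTop, X k ω = fun _ => a := by
  filter_upwards [hX.ae_frequently_of_reach hh (𝓗 := {signField hm hp a}) hK hK' hfield] with ω hω
  have hinf : ∃ᶠ k in atTop, k ∈ K := by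
    obtain ⟨k₀, hk₀⟩ := hne
    -- Two steps, through `K'`, lead from `K` back into `K`, so `K` is infinite.
    have hmem : ∀ m : ℕ, k₀ + 2 * m ∈ K := by
      intro m
      induction m with
      | zero => exact hk₀
      | succ m ih => exact hK' _ (hK _ ih)
    exact frequently_atTop.2 fun b => ⟨k₀ + 2 * b, by omega, hmem b⟩
  obtain ⟨z, hz⟩ := exists_frequently_eq (fun t => X t ω) hinf
  exact (hω _ _ (hind.reach_of_signField hle a hi z) hz).mono fun k hk => hk.2

end IsATVLTD

/-- The field switching between `hm` on `(2m, 2m + 1]` and `hp` on `(2m + 1, 2m + 2]`. -/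
noncomputable def alternatingField (hm hp : V → ℝ) (t : ℝ≥0) : V → ℝ :=
  if Even ⌈t⌉₊ then hp else hm

omit [Fintype V] in
theorem measurable_alternatingField (hm hp : V → ℝ) : Measurable (alternatingField hm hp) :=
  Measurable.ite (Nat.measurable_ceil (MeasurableSet.of_discrete (s := {k | Even k})))
    measurable_const measurable_const

omit [Fintype V] in
theorem alternatingField_mem_Icc {hm hp : V → ℝ} (hle : hm ≤ hp) (t : ℝ≥0) :
    alternatingField hm hp t ∈ Set.Icc hm hp := by
  unfold alternatingField
  split_ifs
  exacts [⟨hle, le_rfl⟩, ⟨le_rfl, hle⟩]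

omit [Fintype V] in
theorem alternatingField_eq (hm hp : V → ℝ) {k : ℕ} {t : ℝ≥0}
    (ht : t ∈ Set.Ioc (k : ℝ≥0) (k + 1 : ℕ)) :
    alternatingField hm hp t = if Even (k + 1) then hp else hm := by
  have : ⌈t⌉₊ = k + 1 := (Nat.ceil_eq_iff (by omega)).2 (by simpa using ht)
  rw [alternatingField, this]

omit [Fintype V] in
theorem exists_le_of_frequently {x : ℝ≥0 → Config V} {z : Config V}
    (hx : ∃ᶠ k : ℕ in atTop, x k = z) (T : ℝ≥0) : ∃ t, T ≤ t ∧ x t = z := by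
  obtain ⟨k, hk, hxk⟩ := (hx.and_eventually (eventually_ge_atTop ⌈T⌉₊)).exists
  exact ⟨k, Nat.ceil_le.1 hxk, hk⟩

end Consensus

/-! ### The main theorem -/

theorem theorem1 {V : Type*} [Fintype V] (G : Network V) (hm hp : V → ℝ) (hle : hm ≤ hp)
    (hind : G.Indecomposable hm hp) :
    (∀ h : ℝ≥0 → V → ℝ, Measurable h → (∀ t, h t ∈ Set.Icc hm hp) →
      ∀ (Ω : Type*) [MeasurableSpace Ω] (P : Measure Ω) [IsProbabilityMeasure P]
        (N : V → ℝ≥0 → Ω → ℕ) (x₀ : Config V) (X : ℝ≥0 → Ω → Config V),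
        IsATVLTD G h x₀ N X P →
        ∀ᵐ ω ∂P, ∃ t₀ : ℝ≥0,
          (X t₀ ω = 1 ∨ X t₀ ω = -1) ∧
          ((∀ i, -hm i < G.outDegree i) → (∀ i, hp i < G.outDegree i) →
            ∀ t, t₀ ≤ t → X t ω = 1 ∨ X t ω = -1) ∧
          (∀ a : ℤˣ,
            (∀ i, -((a : ℤ) : ℝ) * signField hm hp (-a) i < G.outDegree i) →
            ¬ (∀ i, ((a : ℤ) : ℝ) * signField hm hp (-a) i ≤ G.outDegree i) →
            ∀ t, t₀ ≤ t → X t ω = fun _ => a)) ∧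
    (¬ (∀ i, -hm i ≤ G.outDegree i) → ¬ (∀ i, hp i ≤ G.outDegree i) →
      ∃ h : ℝ≥0 → V → ℝ, Measurable h ∧ (∀ t, h t ∈ Set.Icc hm hp) ∧
        ∀ (Ω : Type*) [MeasurableSpace Ω] (P : Measure Ω) [IsProbabilityMeasure P]
          (N : V → ℝ≥0 → Ω → ℕ) (x₀ : Config V) (X : ℝ≥0 → Ω → Config V),
          IsATVLTD G h x₀ N X P →
          ∀ᵐ ω ∂P, ∀ T : ℝ≥0,
            (∃ t, T ≤ t ∧ X t ω = 1) ∧ (∃ t, T ≤ t ∧ X t ω = -1)) := by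
  refine ⟨fun h hmeas hIcc Ω _ P _ N x₀ X hX => ?_, fun hneg hpos =>
    ⟨alternatingField hm hp, measurable_alternatingField hm hp, alternatingField_mem_Icc hle,
      fun Ω _ P _ N x₀ X hX => ?_⟩⟩
  · filter_upwards [hX.ae_frequently_consensus hmeas hle hind hIcc,
      hX.ae_frequently_tickEvent hmeas Set.univ, hX.path,
      ae_all_iff.2 fun i => (hX.clock i).ae_isCountingPath] with ω hcons htick hpath hcount
    obtain ⟨c, hc⟩ := hcons
    -- All clocks tick in `(k₁, k₁ + 1]`. Taking `t₀` after this interval ensures that every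
    -- stubborn node has already settled, so one `t₀` serves all three claims.
    obtain ⟨k₁, -, hk₁⟩ := (htick (fun _ => c) Set.univ (hc.mono fun k hk => ⟨trivial, hk⟩)).exists
    obtain ⟨t₀, ht₀, hct₀⟩ := exists_le_of_frequently (x := fun t => X t ω) hc (k₁ + 1 : ℕ)
    have hct : (fun _ : V => c) = 1 ∨ (fun _ : V => c) = -1 := by
      rcases Int.units_eq_one_or c with rfl | rfl
      exacts [Or.inl rfl, Or.inr rfl]
    refine ⟨t₀, by simpa only [hct₀] using hct, fun h1 h2 t ht => ?_, fun a ha hstub t ht => ?_⟩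
    · have habs : X t ω = fun _ => c := by
        refine hpath.eq_const_of_le hIcc (fun i => ?_) ht hct₀
        rcases Int.units_eq_one_or c with rfl | rfl
        · have : ¬ (-1 : ℤˣ) = 1 := by decide
          simpa [signField, this] using h1 i
        · simpa [signField] using h2 i
      rw [habs]
      exact hct
    · push Not at hstub
      obtain ⟨i, hi⟩ := hstub
      have hi' := hpath.eq_of_stubborn hcount hIcc hi ((hk₁ i).2 trivial) ht₀
      refine hpath.eq_const_of_le hIcc ha ht (hct₀.trans ?_)
      rw [← hi', hct₀]
  · push Not at hneg hpos
    obtain ⟨i, hi⟩ := hneg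
    obtain ⟨j, hj⟩ := hpos
    have hne : ¬ (-1 : ℤˣ) = 1 := by decide
    have hmeas := measurable_alternatingField hm hp
    -- On `(k, k + 1]` the ceiling of the time is `k + 1`, so the field is `hp` after odd `k` and
    -- `hm` after even `k`.
    have hplus := hX.ae_frequently_const hmeas hle hind (a := 1) (i := j)
      (by simpa [signField] using hj) (K := {k | Odd k}) (K' := {k | Even k})
      (fun k hk => Odd.add_one hk) (fun k hk => Even.add_one hk) ⟨1, odd_one⟩ (fun k hk t ht => by
        rw [alternatingField_eq hm hp ht, if_pos (Odd.add_one hk), signField, if_pos rfl])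
    have hminus := hX.ae_frequently_const hmeas hle hind (a := -1) (i := i)
      (by simpa [signField, hne] using hi) (K := {k | Even k}) (K' := {k | Odd k})
      (fun k hk => Even.add_one hk) (fun k hk => Odd.add_one hk) ⟨0, Even.zero⟩
      (fun k hk t ht => by
        rw [alternatingField_eq hm hp ht, if_neg (Nat.not_even_iff_odd.2 (Even.add_one hk)),
          signField, if_neg hne])
    filter_upwards [hplus, hminus] with ω h1 h2 T
    exact ⟨exists_le_of_frequently (x := fun t => X t ω) h1 T,
      exists_le_of_frequently (x := fun t => X t ω) h2 T⟩
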